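/- **Definitions.** All spaces are real. A Banach space $E$ has the *approximation property* (AP) if for every compact $K\subseteq E$ and every $\varepsilon>0$ there is a bounded finite-rank operator $T$ on $E$ with $\|Tx-x\|<\varepsilon$ for all $x\in K$. A bounded operator *can be approximated by finite-rank operators* if it is an operator-norm limit of bounded finite-rank operators. Let $X$ be a real Banach space and $(x_n)_{n\ge1}$ a sequence in $X$ with $\|x_n\|\le 1$ for all $n$ and $\|x_n\|$ decreasing (weakly) to $0$. For $0<t<1$ let $U_t=\overline{\mathrm{conv}}\{\pm x_n/\|x_n\|^t : n\ge1\}$ (terms with $x_n=0$ being read as $0$), let $Y_t$ be the linear span of $U_t$ with the norm $|||x|||_t=\inf\{\lambda>0:\lambda^{-1}x\in U_t\}$, and let $L_t:Y_t\to X$ be the inclusion. Then $Y_s\subseteq Y_t$ for $s<t$. Let $\mathcal Z$ be the linear span of the functions $y\,\chi_{(s,t)}:(0,1)\to X$ with $0<s<t\le 1$ and $y\in Y_s$, with the seminorm $\|f\|=\int_0^1|||f(r)|||_r\,dr$, and let $Z$ be the (Hausdorff) completion of $\mathcal Z$, so that functions at distance $0$ are identified. **Proposition 1.** Let $X$ be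 a real Banach space which does not have the AP. Then there is a sequence $(x_n)$ in $X$ as above such that the identity operator of $X$ cannot be approximated uniformly on $K=\overline{\mathrm{conv}}\{x_n\}_{n\ge1}$ by finite-rank operators. For every such sequence, $Z$ does not have the approximation property. Moreover: 1. $R(y)=2y\,\chi_{(1/2,1)}$ defines a compact operator $R:Y_{1/2}\to Z$; 2. there is a bounded operator $J:Z\to X$ with $J(f)=\int_0^1 f(r)\,dr$ for all $f\in\mathcal Z$, and $JR=L_{1/2}$; 3. $L_{1/2}$ cannot be approximated by finite-rank operators, and neither can $R$. -/

import Mathlib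

open Set MeasureTheory Filter Topology
open scoped Pointwise

noncomputable section

namespace Willis

/-! ### Finite-rank approximation -/

/-- A bounded operator has finite rank if its range is finite dimensional. -/
def IsFiniteRank {E F : Type*} [NormedAddCommGroup E] [NormedSpace ℝ E]
    [NormedAddCommGroup F] [NormedSpace ℝ F] (T : E →L[ℝ] F) : Prop :=
  FiniteDimensional ℝ (LinearMap.range (T : E →ₗ[ℝ] F))

/-- The identity operator of `E` can be approximated, uniformly on `K`, by bounded operators
of finite rank. -/
def IdApproximableOn {E : Type*} [NormedAddCommGroup E] [NormedSpace ℝ E] (K : Set E) : Prop :=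
  ∀ ε : ℝ, 0 < ε → ∃ T : E →L[ℝ] E, IsFiniteRank T ∧ ∀ x ∈ K, ‖T x - x‖ < ε

/-- The approximation property. -/
def HasAP (E : Type*) [NormedAddCommGroup E] [NormedSpace ℝ E] : Prop :=
  ∀ K : Set E, IsCompact K → IdApproximableOn K

/-- The operator `T` is a norm limit of bounded operators of finite rank. -/
def FiniteRankApproximable {E F : Type*} [NormedAddCommGroup E] [NormedSpace ℝ E]
    [NormedAddCommGroup F] [NormedSpace ℝ F] (T : E →L[ℝ] F) : Prop :=
  ∀ ε : ℝ, 0 < ε → ∃ S : E →L[ℝ] F, IsFiniteRank S ∧ ‖T - S‖ < ε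

/-! ### The gauge on the span of an absolutely convex set -/

section Gauge

variable {X : Type*} [NormedAddCommGroup X] [NormedSpace ℝ X]

theorem exists_mem_smul_of_mem_span {A : Set X} (hA : AbsConvex ℝ A) (h0 : (0 : X) ∈ A) {x : X}
    (hx : x ∈ Submodule.span ℝ A) : ∃ r : ℝ, 0 < r ∧ x ∈ r • A := by
  induction hx using Submodule.span_induction with
  | mem x h => exact ⟨1, one_pos, by simpa using h⟩
  | zero => exact ⟨1, one_pos, by simpa using h0⟩
  | add x y _ _ hx hy =>
    obtain ⟨r, hr, hx⟩ := hx
    obtain ⟨s, hs, hy⟩ := hy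
    refine ⟨r + s, by positivity, ?_⟩
    rw [hA.2.add_smul hr.le hs.le]
    exact Set.add_mem_add hx hy
  | smul c x _ hx =>
    obtain ⟨r, hr, hx⟩ := hx
    refine ⟨(|c| + 1) * r, by positivity, ?_⟩
    obtain ⟨u, hu, rfl⟩ := hx
    refine hA.1.smul_mono (a := c * r) ?_ ?_
    · rw [norm_mul, norm_mul]
      gcongr
      rw [Real.norm_eq_abs, Real.norm_eq_abs, abs_of_nonneg (by positivity : 0 ≤ |c| + 1)]
      linarith
    · exact ⟨u, hu, by simp [mul_smul]⟩

theorem absorbent_preimage {A : Set X} (hA : AbsConvex ℝ A) (h0 : (0 : X) ∈ A) :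
    Absorbent ℝ (((↑) : Submodule.span ℝ A → X) ⁻¹' A) := by
  intro y
  obtain ⟨r, hr, u, hu, hy⟩ := exists_mem_smul_of_mem_span hA h0 y.2
  rw [absorbs_iff_norm]
  refine ⟨r, fun c hc => ?_⟩
  have hc0 : c ≠ 0 := by
    rintro rfl
    simp at hc
    linarith
  rw [singleton_subset_iff, mem_smul_set_iff_inv_smul_mem₀ hc0]
  change c⁻¹ • (y : X) ∈ A
  rw [← mem_smul_set_iff_inv_smul_mem₀ hc0]
  refine hA.1.smul_mono (a := r) ?_ ⟨u, hu, hy⟩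
  rwa [Real.norm_of_nonneg hr.le]

theorem gauge_preimage {A : Set X} (y : Submodule.span ℝ A) :
    gauge (((↑) : Submodule.span ℝ A → X) ⁻¹' A) y = gauge A (y : X) := by
  rw [gauge_def', gauge_def']
  rfl

theorem gauge_add_le_of_mem_span {A : Set X} (hA : AbsConvex ℝ A) (h0 : (0 : X) ∈ A) {x y : X}
    (hx : x ∈ Submodule.span ℝ A) (hy : y ∈ Submodule.span ℝ A) :
    gauge A (x + y) ≤ gauge A x + gauge A y := by
  have h := gauge_add_le (s := ((↑) : Submodule.span ℝ A → X) ⁻¹' A)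
    (hA.2.linear_preimage (Submodule.span ℝ A).subtype) (absorbent_preimage hA h0) ⟨x, hx⟩ ⟨y, hy⟩
  rwa [gauge_preimage, gauge_preimage, gauge_preimage] at h

theorem gauge_anti_of_mem_span {A B : Set X} (hA : AbsConvex ℝ A) (h0 : (0 : X) ∈ A)
    (hAB : A ⊆ B) {x : X} (hx : x ∈ Submodule.span ℝ A) : gauge B x ≤ gauge A x := by
  rw [gauge_def, gauge_def]
  refine csInf_le_csInf ⟨0, fun r hr => (mem_Ioi.1 hr.1).le⟩ ?_
    fun r hr => ⟨hr.1, smul_set_mono hAB hr.2⟩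
  obtain ⟨r, hr, h⟩ := exists_mem_smul_of_mem_span hA h0 hx
  exact ⟨r, hr, h⟩

theorem norm_le_gauge {A : Set X} (hA : AbsConvex ℝ A) (h0 : (0 : X) ∈ A)
    (h1 : A ⊆ Metric.closedBall 0 1) {x : X} (hx : x ∈ Submodule.span ℝ A) :
    ‖x‖ ≤ gauge A x := by
  have h := gauge_anti_of_mem_span hA h0 h1 hx
  rwa [gauge_closedBall zero_le_one, div_one] at h

end Gauge

/-! ### The sets `U_t` and the spaces `Y_t` -/

/-- A sequence in the unit ball whose norms decrease (weakly) to zero. -/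
structure NullSeq (X : Type*) [NormedAddCommGroup X] where
  seq : ℕ → X
  norm_le_one : ∀ n, ‖seq n‖ ≤ 1
  antitone_norm : Antitone fun n => ‖seq n‖
  tendsto_norm : Tendsto (fun n => ‖seq n‖) atTop (𝓝 0)

variable {X : Type*} [NormedAddCommGroup X] [NormedSpace ℝ X]

/-- The closed convex hull `K` of the sequence. -/
def NullSeq.hull (a : NullSeq X) : Set X :=
  closure (convexHull ℝ (range a.seq))

/-- The vectors `x_n / ‖x_n‖ ^ t`. -/
def NullSeq.scaled (a : NullSeq X) (t : ℝ) (n : ℕ) : X :=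
  (‖a.seq n‖ ^ t)⁻¹ • a.seq n

/-- `U_t`, the closed convex hull of the vectors `± x_n / ‖x_n‖ ^ t`. -/
def NullSeq.U (a : NullSeq X) (t : ℝ) : Set X :=
  closure (convexHull ℝ (range (a.scaled t) ∪ -range (a.scaled t)))

/-- `Y_t` as a linear subspace of `X`: the linear span of `U_t`. -/
def NullSeq.spanU (a : NullSeq X) (t : ℝ) : Submodule ℝ X :=
  Submodule.span ℝ (a.U t)

section U

variable (a : NullSeq X)

theorem NullSeq.absConvex_U (t : ℝ) : AbsConvex ℝ (a.U t) := by
  rw [NullSeq.U, convexHull_union_neg_eq_absConvexHull]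
  exact absConvex_absConvexHull.closure

theorem NullSeq.subset_U (t : ℝ) : range (a.scaled t) ∪ -range (a.scaled t) ⊆ a.U t :=
  (subset_convexHull ℝ _).trans subset_closure

theorem NullSeq.zero_mem_U (t : ℝ) : (0 : X) ∈ a.U t :=
  (a.absConvex_U t).1.zero_mem ⟨_, a.subset_U t (Or.inl ⟨0, rfl⟩)⟩

theorem NullSeq.U_subset {t : ℝ} {B : Set X} (hB : AbsConvex ℝ B) (hc : IsClosed B)
    (h : ∀ n, a.scaled t n ∈ B) : a.U t ⊆ B := by
  rw [NullSeq.U, convexHull_union_neg_eq_absConvexHull]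
  exact closure_minimal (absConvexHull_min (range_subset_iff.2 h) hB) hc

theorem NullSeq.U_mono : Monotone a.U := by
  intro s t hst
  refine a.U_subset (a.absConvex_U t) isClosed_closure fun n => ?_
  have hn : a.scaled t n ∈ a.U t := a.subset_U t (Or.inl ⟨n, rfl⟩)
  by_cases h0 : a.seq n = 0
  · simpa [NullSeq.scaled, h0] using a.zero_mem_U t
  have hpos : 0 < ‖a.seq n‖ := norm_pos_iff.2 h0
  have h : a.scaled s n = (‖a.seq n‖ ^ (t - s)) • a.scaled t n := by
    rw [NullSeq.scaled, NullSeq.scaled, smul_smul, ← Real.rpow_neg hpos.le,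
      ← Real.rpow_neg hpos.le, ← Real.rpow_add hpos]
    congr 2
    ring
  rw [h]
  refine (a.absConvex_U t).1.smul_mem ?_ hn
  rw [Real.norm_of_nonneg (by positivity)]
  exact Real.rpow_le_one hpos.le (a.norm_le_one n) (by linarith)

theorem NullSeq.U_subset_closedBall {t : ℝ} (ht : t ≤ 1) : a.U t ⊆ Metric.closedBall 0 1 := by
  refine (a.U_mono ht).trans (a.U_subset ⟨balanced_closedBall_zero, convex_closedBall _ _⟩
    Metric.isClosed_closedBall fun n => ?_)
  rw [mem_closedBall_zero_iff, NullSeq.scaled, norm_smul, norm_inv, Real.rpow_one, norm_norm]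
  exact inv_mul_le_one

theorem NullSeq.spanU_mono : Monotone a.spanU := fun _ _ h => Submodule.span_mono (a.U_mono h)

end U

/-- The linear space `Y_t`, `0 < t < 1`, carrying its own norm (not the norm of `X`). -/
def NullSeq.Y (a : NullSeq X) (t : Ioo (0 : ℝ) 1) : Type _ := a.spanU t

instance (a : NullSeq X) (t : Ioo (0 : ℝ) 1) : AddCommGroup (a.Y t) :=
  inferInstanceAs (AddCommGroup (a.spanU t))

instance (a : NullSeq X) (t : Ioo (0 : ℝ) 1) : Module ℝ (a.Y t) :=
  inferInstanceAs (Module ℝ (a.spanU t))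

/-- The inclusion of `Y_t` in `X`, as a linear map. -/
def NullSeq.incl (a : NullSeq X) (t : Ioo (0 : ℝ) 1) : a.Y t →ₗ[ℝ] X := (a.spanU t).subtype

/-- The norm of `Y_t`: `|||x|||_t = inf {r > 0 : r⁻¹ x ∈ U_t}`. -/
instance (a : NullSeq X) (t : Ioo (0 : ℝ) 1) : Norm (a.Y t) :=
  ⟨fun y => gauge (a.U t) (a.incl t y)⟩

theorem NullSeq.norm_def (a : NullSeq X) (t : Ioo (0 : ℝ) 1) (y : a.Y t) :
    ‖y‖ = gauge (a.U t) (a.incl t y) := rfl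

theorem NullSeq.norm_incl_le (a : NullSeq X) (t : Ioo (0 : ℝ) 1) (y : a.Y t) :
    ‖a.incl t y‖ ≤ ‖y‖ :=
  norm_le_gauge (a.absConvex_U t) (a.zero_mem_U t) (a.U_subset_closedBall t.2.2.le) y.2

theorem NullSeq.normCore (a : NullSeq X) (t : Ioo (0 : ℝ) 1) : NormedSpace.Core ℝ (a.Y t) where
  norm_nonneg y := gauge_nonneg _
  norm_smul c y := by
    rw [a.norm_def, a.norm_def, map_smul, gauge_smul (a.absConvex_U t).1]
  norm_triangle x y := by
    rw [a.norm_def, a.norm_def, a.norm_def, map_add]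
    exact gauge_add_le_of_mem_span (a.absConvex_U t) (a.zero_mem_U t) x.2 y.2
  norm_eq_zero_iff y := by
    constructor
    · intro h
      have h1 := a.norm_incl_le t y
      rw [h] at h1
      exact Subtype.ext (norm_le_zero_iff.1 h1)
    · rintro rfl
      rw [a.norm_def, map_zero, gauge_zero]

instance (a : NullSeq X) (t : Ioo (0 : ℝ) 1) : NormedAddCommGroup (a.Y t) :=
  NormedAddCommGroup.ofCore (a.normCore t)

instance (a : NullSeq X) (t : Ioo (0 : ℝ) 1) : NormedSpace ℝ (a.Y t) :=
  NormedSpace.ofCore (a.normCore t)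

/-- `L_t`, the inclusion of `Y_t` in `X` as a bounded operator. -/
def NullSeq.L (a : NullSeq X) (t : Ioo (0 : ℝ) 1) : a.Y t →L[ℝ] X :=
  (a.incl t).mkContinuous 1 fun y => by simpa using a.norm_incl_le t y

/-! ### The space `Z` -/

/-- The functions `y χ_(s,t)` with `(s,t) ⊆ (0,1)` and `y ∈ Y_s`. They vanish outside `(0,1)` and
are regarded as functions on the whole real line. -/
def NullSeq.steps (a : NullSeq X) : Set (ℝ → X) :=
  {f | ∃ s t : ℝ, ∃ y : X, 0 < s ∧ s < t ∧ t ≤ 1 ∧ y ∈ a.spanU s ∧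
    f = (Ioo s t).indicator fun _ => y}

/-- The linear span of the functions `y χ_(s,t)`. -/
def NullSeq.spanSteps (a : NullSeq X) : Submodule ℝ (ℝ → X) :=
  Submodule.span ℝ a.steps

section Steps

variable (a : NullSeq X)

theorem NullSeq.spanSteps_apply_mem {f : ℝ → X} (hf : f ∈ a.spanSteps) (r : ℝ) :
    f r ∈ a.spanU r := by
  induction hf using Submodule.span_induction with
  | mem f h =>
    obtain ⟨s, t, y, -, -, -, hy, rfl⟩ := h
    by_cases hr : r ∈ Ioo s t
    · rw [indicator_of_mem hr]
      exact a.spanU_mono hr.1.le hy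
    · rw [indicator_of_notMem hr]
      exact zero_mem _
  | zero => exact zero_mem _
  | add f g _ _ hf hg => exact add_mem hf hg
  | smul c f _ hf => exact Submodule.smul_mem _ c hf

theorem NullSeq.exists_simpleFunc {f : ℝ → X} (hf : f ∈ a.spanSteps) :
    ∃ F : SimpleFunc ℝ X, ⇑F = f := by
  induction hf using Submodule.span_induction with
  | mem f h =>
    obtain ⟨s, t, y, -, -, -, hy, rfl⟩ := h
    classical
    refine ⟨SimpleFunc.piecewise (Ioo s t) measurableSet_Ioo (SimpleFunc.const ℝ y)
      (SimpleFunc.const ℝ 0), ?_⟩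
    rw [SimpleFunc.coe_piecewise]
    ext r
    by_cases hr : r ∈ Ioo s t <;> simp [Set.piecewise, hr]
  | zero => exact ⟨0, rfl⟩
  | add f g _ _ hf hg =>
    obtain ⟨F, rfl⟩ := hf
    obtain ⟨G, rfl⟩ := hg
    exact ⟨F + G, rfl⟩
  | smul c f _ hf =>
    obtain ⟨F, rfl⟩ := hf
    exact ⟨c • F, rfl⟩

theorem NullSeq.measurable_gauge (y : X) : Measurable fun r : ℝ => gauge (a.U r) y := by
  classical
  have h : Antitone fun r : ℝ =>
      if y ∈ a.spanU r then ENNReal.ofReal (gauge (a.U r) y) else ⊤ := by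
    intro r s hrs
    by_cases hr : y ∈ a.spanU r
    · simp only [hr, a.spanU_mono hrs hr, if_true]
      exact ENNReal.ofReal_le_ofReal
        (gauge_anti_of_mem_span (a.absConvex_U r) (a.zero_mem_U r) (a.U_mono hrs) hr)
    · simp [hr]
  convert h.measurable.ennreal_toReal using 2 with r
  by_cases hr : y ∈ a.spanU r
  · simp [hr, ENNReal.toReal_ofReal (gauge_nonneg _)]
  · simp only [hr, if_false, ENNReal.toReal_top]
    rw [gauge_def]
    convert Real.sInf_empty
    refine eq_empty_of_forall_notMem fun c hc => hr ?_
    obtain ⟨u, hu, rfl⟩ := hc.2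
    exact Submodule.smul_mem _ _ (Submodule.subset_span hu)

theorem NullSeq.measurable_gauge_apply {f : ℝ → X} (hf : f ∈ a.spanSteps) :
    Measurable fun r => gauge (a.U r) (f r) := by
  obtain ⟨F, rfl⟩ := a.exists_simpleFunc hf
  exact F.measurable_bind (fun y r => gauge (a.U r) y) a.measurable_gauge

theorem NullSeq.gauge_add_le {f g : ℝ → X} (hf : f ∈ a.spanSteps) (hg : g ∈ a.spanSteps) (r : ℝ) :
    gauge (a.U r) ((f + g) r) ≤ gauge (a.U r) (f r) + gauge (a.U r) (g r) :=
  gauge_add_le_of_mem_span (a.absConvex_U r) (a.zero_mem_U r) (a.spanSteps_apply_mem hf r)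
    (a.spanSteps_apply_mem hg r)

/-- The integrand in the norm of `Z` is integrable. -/
theorem NullSeq.integrableOn_gauge {f : ℝ → X} (hf : f ∈ a.spanSteps) :
    IntegrableOn (fun r => gauge (a.U r) (f r)) (Ioo 0 1) := by
  suffices h : ∃ C : ℝ, ∀ r, gauge (a.U r) (f r) ≤ C by
    obtain ⟨C, hC⟩ := h
    refine Measure.integrableOn_of_bounded (M := C) (by simp)
      (a.measurable_gauge_apply hf).aestronglyMeasurable (ae_of_all _ fun r => ?_)
    rw [Real.norm_of_nonneg (gauge_nonneg _)]
    exact hC r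
  have hf' : f ∈ Submodule.span ℝ a.steps := hf
  clear hf
  induction hf' using Submodule.span_induction with
  | mem f h =>
    obtain ⟨s, t, y, -, -, -, hy, rfl⟩ := h
    refine ⟨gauge (a.U s) y, fun r => ?_⟩
    by_cases hr : r ∈ Ioo s t
    · rw [indicator_of_mem hr]
      exact gauge_anti_of_mem_span (a.absConvex_U s) (a.zero_mem_U s) (a.U_mono hr.1.le) hy
    · rw [indicator_of_notMem hr, gauge_zero]
      exact gauge_nonneg _
  | zero => exact ⟨0, fun r => by simp [gauge_zero]⟩
  | add f g hf hg h1 h2 =>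
    obtain ⟨C, hC⟩ := h1
    obtain ⟨D, hD⟩ := h2
    exact ⟨C + D, fun r => (a.gauge_add_le hf hg r).trans (add_le_add (hC r) (hD r))⟩
  | smul c f _ hf =>
    obtain ⟨C, hC⟩ := hf
    refine ⟨‖c‖ * C, fun r => ?_⟩
    rw [Pi.smul_apply, gauge_smul (a.absConvex_U r).1]
    exact mul_le_mul_of_nonneg_left (hC r) (norm_nonneg c)

end Steps

/-- The linear space of step functions, carrying the seminorm `‖f‖ = ∫₀¹ |||f(r)|||_r dr`. -/
def NullSeq.ZStep (a : NullSeq X) : Type _ := a.spanSteps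

instance (a : NullSeq X) : AddCommGroup a.ZStep := inferInstanceAs (AddCommGroup a.spanSteps)

instance (a : NullSeq X) : Module ℝ a.ZStep := inferInstanceAs (Module ℝ a.spanSteps)

/-- The function underlying an element of the space of step functions. -/
def NullSeq.toFun (a : NullSeq X) : a.ZStep →ₗ[ℝ] (ℝ → X) := a.spanSteps.subtype

instance (a : NullSeq X) : Norm a.ZStep :=
  ⟨fun f => ∫ r in Ioo (0 : ℝ) 1, gauge (a.U r) (a.toFun f r)⟩

theorem NullSeq.normZ_def (a : NullSeq X) (f : a.ZStep) :
    ‖f‖ = ∫ r in Ioo (0 : ℝ) 1, gauge (a.U r) (a.toFun f r) := rfl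

theorem NullSeq.seminormCore (a : NullSeq X) : SeminormedSpace.Core ℝ a.ZStep where
  norm_nonneg f := integral_nonneg fun r => gauge_nonneg _
  norm_smul c f := by
    rw [a.normZ_def, a.normZ_def, map_smul, ← integral_const_mul]
    refine integral_congr_ae (ae_of_all _ fun r => ?_)
    simp only [Pi.smul_apply]
    rw [gauge_smul (a.absConvex_U r).1]
  norm_triangle f g := by
    rw [a.normZ_def, a.normZ_def, a.normZ_def, map_add]
    refine le_of_le_of_eq ?_
      (integral_add (a.integrableOn_gauge f.2) (a.integrableOn_gauge g.2))
    refine integral_mono ?_ ((a.integrableOn_gauge f.2).add (a.integrableOn_gauge g.2)) fun r => ?_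
    · exact a.integrableOn_gauge (f + g).2
    · exact a.gauge_add_le f.2 g.2 r

instance (a : NullSeq X) : SeminormedAddCommGroup a.ZStep :=
  SeminormedAddCommGroup.ofCore a.seminormCore

instance (a : NullSeq X) : NormedSpace ℝ a.ZStep :=
  { norm_smul_le := fun c f => (a.seminormCore.norm_smul c f).le }

/-- The Banach space `Z`: the Hausdorff completion of the space of step functions. (Step functions
that differ only at finitely many points are at distance zero, hence are identified in `Z`.) -/
abbrev NullSeq.Z (a : NullSeq X) : Type _ := UniformSpace.Completion a.ZStep

/-- The number `1/2` as a point of `(0,1)`. -/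
def half : Ioo (0 : ℝ) 1 := ⟨1 / 2, by norm_num, by norm_num⟩

/-- The step function `y χ_(1/2,1)`, for `y ∈ Y_{1/2}`. -/
def NullSeq.halfStep (a : NullSeq X) (y : a.Y half) : a.ZStep :=
  ⟨(Ioo (1 / 2) 1).indicator fun _ => a.incl half y,
    Submodule.subset_span ⟨1 / 2, 1, a.incl half y, by norm_num, by norm_num, le_rfl, y.2, rfl⟩⟩

end Willis

end

namespace Willis

/-! ### Compact sets and null sequences -/

section NullSequences

variable {X : Type*} [NormedAddCommGroup X] [NormedSpace ℝ X]

/-! A compact set on which the identity of `X` is not approximable lies, up to scaling, in the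
closed convex hull of a null sequence (Grothendieck), whose norms can be made decreasing; this
yields the sequence.

For `s < t`, the factor `‖x_n‖ ^ (t - s)` between the generators of `U_s` and those of `U_t` tends
to `0`. Hence `U_s` sits in the closed absolutely convex hull of a null sequence of the Banach space
`Y_t`, and `Y_s → Y_t` is compact (`isCompactOperator_inclIn`). The space `Z` glues all the `Y_t`
together: `y ↦ y χ_(s,1)` differs by at most `t - s` in norm from a map that factors through `Y_s →
Y_t`, so letting `t` decrease to `s` shows that it is compact (`isCompactOperator_step`).
Integration recovers `L_{1/2}` as `J ∘ R`.

If `Z` had the AP, the compact operator `R`, and with it `L_{1/2} = J ∘ R`, would be a limit of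
finite-rank operators. This is impossible: a finite-rank approximant of `L_t` involves functionals
on `Y_t` that need not extend to `X`, but on the compact hull of the `x_n` in `Y_t` functionals on
`X` approximate them uniformly (`exists_dual_approx`), which gives finite-rank operators on `X`
close to the identity on `K` (`idApproximableOn_hull`). -/

theorem NullSeq.isClosed_hull (a : NullSeq X) : IsClosed a.hull := isClosed_closure

theorem NullSeq.convex_hull (a : NullSeq X) : Convex ℝ a.hull := (convex_convexHull ℝ _).closure

theorem NullSeq.seq_mem_hull (a : NullSeq X) (n : ℕ) : a.seq n ∈ a.hull :=
  subset_closure (subset_convexHull ℝ _ ⟨n, rfl⟩)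

theorem NullSeq.zero_mem_hull (a : NullSeq X) : (0 : X) ∈ a.hull :=
  a.isClosed_hull.mem_of_tendsto (tendsto_zero_iff_norm_tendsto_zero.2 a.tendsto_norm)
    (Eventually.of_forall a.seq_mem_hull)

/-- Every null sequence in the unit ball lies in the hull of a null sequence with decreasing
norms. -/
theorem exists_nullSeq_range_subset_hull [Nontrivial X] {z : ℕ → X} (h1 : ∀ n, ‖z n‖ ≤ 1)
    (hz : Tendsto (fun n => ‖z n‖) atTop (𝓝 0)) : ∃ a : NullSeq X, range z ⊆ a.hull := by
  classical
  obtain ⟨e, he⟩ := exists_norm_eq X (zero_le_one' ℝ)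
  -- The least decreasing majorant of the norms. Each `z n` is stretched to norm `c n`, so that it
  -- lies on the segment from `0` to the new vector.
  set c : ℕ → ℝ := fun n => ⨆ m, ‖z (n + m)‖ with hc
  have hb : ∀ n, BddAbove (range fun m => ‖z (n + m)‖) := fun n =>
    ⟨1, forall_mem_range.2 fun m => h1 _⟩
  have hle : ∀ n, ‖z n‖ ≤ c n := fun n => le_ciSup (hb n) 0
  have hc0 : ∀ n, 0 ≤ c n := fun n => (norm_nonneg _).trans (hle n)
  have hc1 : ∀ n, c n ≤ 1 := fun n => ciSup_le fun m => h1 _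
  have hanti : Antitone c := by
    intro n m hnm
    refine ciSup_le fun k => ?_
    have h := le_ciSup (hb n) (m - n + k)
    rwa [← add_assoc, Nat.add_sub_cancel' hnm] at h
  have hlim : Tendsto c atTop (𝓝 0) := by
    rw [Metric.tendsto_atTop] at hz ⊢
    intro ε hε
    obtain ⟨N, hN⟩ := hz (ε / 2) (half_pos hε)
    refine ⟨N, fun n hn => ?_⟩
    rw [Real.dist_0_eq_abs, abs_of_nonneg (hc0 n)]
    refine lt_of_le_of_lt (ciSup_le fun m => ?_) (half_lt_self hε)
    have h := hN (n + m) (hn.le.trans (Nat.le_add_right n m))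
    rw [Real.dist_0_eq_abs, abs_norm] at h
    exact h.le
  -- Where `z n = 0` there is no direction to stretch; a fixed unit vector `e` keeps the norm equal
  -- to `c n`.
  set w : ℕ → X := fun n => if z n = 0 then c n • e else (c n / ‖z n‖) • z n with hw
  have hwn : ∀ n, ‖w n‖ = c n := by
    intro n
    by_cases h0 : z n = 0
    · simp only [hw, h0, if_true, norm_smul, he, mul_one]
      exact Real.norm_of_nonneg (hc0 n)
    · have hpos : 0 < ‖z n‖ := norm_pos_iff.2 h0
      simp only [hw, h0, if_false, norm_smul]
      rw [Real.norm_of_nonneg (div_nonneg (hc0 n) hpos.le), div_mul_cancel₀ _ hpos.ne']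
  have hfun : (fun n => ‖w n‖) = c := funext hwn
  let a : NullSeq X :=
    { seq := w
      norm_le_one := fun n => (hwn n).trans_le (hc1 n)
      antitone_norm := by rw [hfun]; exact hanti
      tendsto_norm := by rw [hfun]; exact hlim }
  refine ⟨a, range_subset_iff.2 fun n => ?_⟩
  by_cases h0 : z n = 0
  · rw [h0]; exact a.zero_mem_hull
  have hpos : 0 < ‖z n‖ := norm_pos_iff.2 h0
  have hcpos : 0 < c n := hpos.trans_le (hle n)
  have h : z n = (‖z n‖ / c n) • a.seq n := by
    change z n = (‖z n‖ / c n) • w n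
    simp only [hw, h0, if_false, smul_smul]
    rw [div_mul_div_cancel₀ hcpos.ne', div_self hpos.ne', one_smul]
  rw [h]
  exact a.convex_hull.smul_mem_of_zero_mem a.zero_mem_hull (a.seq_mem_hull n)
    ⟨by positivity, div_le_one_of_le₀ (hle n) hcpos.le⟩

/-- The weights sum to less than `1`, and `0` takes the missing mass. The induction splits off `v
0`: the sum is the midpoint of `v 0` and the same sum for the shifted sequence. -/
theorem _root_.Convex.sum_range_two_pow_smul_mem {C : Set X} (hC : Convex ℝ C) (h0 : (0 : X) ∈ C)
    (n : ℕ) : ∀ v : ℕ → X, (∀ k, v k ∈ C) →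
      ∑ k ∈ Finset.range n, ((1 / 2 : ℝ) ^ (k + 1)) • v k ∈ C := by
  induction n with
  | zero => intro v _; simpa using h0
  | succ n ih =>
    intro v hv
    have h := hC (ih (fun k => v (k + 1)) fun k => hv _) (hv 0)
      (by norm_num : (0 : ℝ) ≤ 1 / 2) (by norm_num : (0 : ℝ) ≤ 1 / 2) (by norm_num)
    rw [Finset.sum_range_succ']
    convert h using 2
    · rw [Finset.smul_sum]
      refine Finset.sum_congr rfl fun k _ => ?_
      rw [smul_smul]
      congr 1
      ring
    · norm_num

/-- A compact set lies in the closed convex hull of a null sequence (Grothendieck). -/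
theorem _root_.IsCompact.exists_null_seq_subset_closure_convexHull {K : Set X} (hK : IsCompact K) :
    ∃ z : ℕ → X, Tendsto (fun n => ‖z n‖) atTop (𝓝 0) ∧
      K ⊆ closure (convexHull ℝ (range z)) := by
  obtain ⟨M, hM, hKM⟩ := hK.isBounded.subset_ball_lt 0 0
  have hr : ∀ k : ℕ, 0 < M * (1 / 4) ^ k := fun k => by positivity
  -- Finite nets of mesh `M / 4 ^ k`. Since `K` lies in the ball of radius `M`, the net at level `0`
  -- can be `{0}`, so the telescoping sum below starts at `0`.
  have hF : ∀ k : ℕ, ∃ t : Set X, t.Finite ∧ (k = 0 → t = {0}) ∧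
      ∀ x ∈ K, ∃ f ∈ t, ‖x - f‖ < M * (1 / 4) ^ k := by
    intro k
    rcases Nat.eq_zero_or_pos k with rfl | hk
    · refine ⟨{0}, finite_singleton _, fun _ => rfl, fun x hx => ⟨0, rfl, ?_⟩⟩
      simpa using hKM hx
    · obtain ⟨t, ht, hKt⟩ := Metric.totallyBounded_iff.1 hK.totallyBounded _ (hr k)
      refine ⟨t, ht, fun h => absurd h hk.ne', fun x hx => ?_⟩
      obtain ⟨f, hf, hxf⟩ := mem_iUnion₂.1 (hKt hx)
      exact ⟨f, hf, by rwa [← dist_eq_norm]⟩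
  choose F hFfin hF0 hFK using hF
  -- The possible increments between consecutive nets. Including `0` makes every `D k` nonempty, so
  -- that the disjoint union is infinite and can be enumerated by `ℕ`.
  let D : ℕ → Set X := fun k => insert 0 ((F (k + 1) - F k) ∩ {d | ‖d‖ ≤ 2 * (M * (1 / 4) ^ k)})
  have hDfin : ∀ k, Finite (D k) := fun k =>
    (((hFfin (k + 1)).sub (hFfin k)).inter_of_left _ |>.insert 0).to_subtype
  have hDle : ∀ k, ∀ d ∈ D k, ‖d‖ ≤ 2 * (M * (1 / 4) ^ k) := by
    rintro k d (rfl | hd)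
    · rw [norm_zero]
      have := hr k
      positivity
    · exact hd.2
  have : Infinite (Σ k, D k) :=
    Infinite.of_injective (fun k => (⟨k, 0, mem_insert _ _⟩ : Σ k, D k)) fun k l h =>
      (Sigma.mk.inj_iff.1 h).1
  obtain ⟨_⟩ := nonempty_denumerable (Σ k, D k)
  -- The increments are of order `4 ^ (-k)`: after multiplication by `2 ^ (k + 1)` they still tend
  -- to `0`, and the weights `2 ^ (-(k + 1))` that undo this are those of a convex combination with
  -- `0`.
  let y : (Σ k, D k) → X := fun i => (2 : ℝ) ^ (i.1 + 1) • (i.2 : X)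
  have hy : ∀ i, ‖y i‖ ≤ 4 * M * (1 / 2) ^ i.1 := by
    rintro ⟨k, d, hd⟩
    have h : (2 : ℝ) ^ (k + 1) * (2 * (M * (1 / 4) ^ k)) = 4 * M * (1 / 2) ^ k := by
      have h2 : (1 / 4 : ℝ) ^ k = (1 / 2) ^ k * (1 / 2) ^ k := by
        rw [← mul_pow]; norm_num
      have h3 : (2 : ℝ) ^ k * (1 / 2) ^ k = 1 := by
        rw [← mul_pow]; norm_num
      rw [h2, pow_succ]
      linear_combination (4 * M * (1 / 2) ^ k) * h3
    rw [← h]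
    change ‖(2 : ℝ) ^ (k + 1) • d‖ ≤ _
    rw [norm_smul, norm_pow, Real.norm_two]
    exact mul_le_mul_of_nonneg_left (hDle k d hd) (by positivity)
  -- Only finitely many indices have a given level, so the norms tend to `0` in any enumeration.
  have hylim : Tendsto (fun i => ‖y i‖) cofinite (𝓝 0) := by
    refine squeeze_zero (fun _ => norm_nonneg _) hy ?_
    have h1 : Tendsto (fun k : ℕ => 4 * M * (1 / 2 : ℝ) ^ k) atTop (𝓝 0) := by
      simpa using (tendsto_pow_atTop_nhds_zero_of_lt_one (by norm_num : (0 : ℝ) ≤ 1 / 2)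
        (by norm_num)).const_mul (4 * M)
    refine h1.comp ?_
    rw [← Nat.cofinite_eq_atTop]
    refine Tendsto.cofinite_of_finite_preimage_singleton fun k => ?_
    refine (finite_range fun d : D k => (⟨k, d⟩ : Σ k, D k)).subset ?_
    rintro ⟨l, d⟩ hl
    obtain rfl : l = k := hl
    exact ⟨d, rfl⟩
  let q := (Denumerable.eqv (Σ k, D k)).symm
  refine ⟨y ∘ q, ?_, fun x hx => ?_⟩
  · refine hylim.comp ?_
    rw [← Nat.cofinite_eq_atTop]
    exact q.injective.tendsto_cofinite
  rw [q.surjective.range_comp]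
  choose f hfF hf using fun k => hFK k x hx
  have hfD : ∀ k, f (k + 1) - f k ∈ D k := by
    intro k
    refine Or.inr ⟨Set.sub_mem_sub (hfF _) (hfF _), ?_⟩
    have h1 := hf k
    have h2 := hf (k + 1)
    have h3 : M * (1 / 4 : ℝ) ^ (k + 1) ≤ M * (1 / 4) ^ k := by
      rw [pow_succ]
      nlinarith [hr k]
    calc ‖f (k + 1) - f k‖ = ‖(x - f k) - (x - f (k + 1))‖ := by congr 1; abel
      _ ≤ ‖x - f k‖ + ‖x - f (k + 1)‖ := norm_sub_le _ _
      _ ≤ 2 * (M * (1 / 4) ^ k) := by linarith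
  have hlim : Tendsto f atTop (𝓝 x) := by
    rw [tendsto_iff_norm_sub_tendsto_zero]
    refine squeeze_zero (fun _ => norm_nonneg _)
      (fun k => (norm_sub_rev (f k) x).trans_le (hf k).le) ?_
    simpa using (tendsto_pow_atTop_nhds_zero_of_lt_one (by norm_num : (0 : ℝ) ≤ 1 / 4)
      (by norm_num)).const_mul M
  refine mem_closure_of_tendsto hlim (Eventually.of_forall fun n => ?_)
  have h0 : (0 : X) ∈ convexHull ℝ (range y) :=
    subset_convexHull ℝ _ ⟨⟨0, 0, mem_insert _ _⟩, smul_zero _⟩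
  have hmem := (convex_convexHull ℝ (range y)).sum_range_two_pow_smul_mem h0 n
    (fun k => y ⟨k, _, hfD k⟩) fun k => subset_convexHull ℝ _ ⟨_, rfl⟩
  have hf0 : f 0 = 0 := by
    have h := hfF 0
    rw [hF0 0 rfl] at h
    exact h
  have hsum : ∑ k ∈ Finset.range n, ((1 / 2 : ℝ) ^ (k + 1)) • y ⟨k, _, hfD k⟩ = f n := by
    have h := Finset.sum_range_sub f n
    rw [hf0, sub_zero] at h
    rw [← h]
    refine Finset.sum_congr rfl fun k _ => ?_
    change ((1 / 2 : ℝ) ^ (k + 1)) • (2 : ℝ) ^ (k + 1) • (f (k + 1) - f k) = _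
    rw [smul_smul, ← mul_pow]
    norm_num
  rwa [hsum] at hmem

theorem exists_nullSeq_not_idApproximableOn (hX : ¬ HasAP X) :
    ∃ a : NullSeq X, ¬ IdApproximableOn a.hull := by
  have : Nontrivial X := by
    by_contra h
    rw [not_nontrivial_iff_subsingleton] at h
    refine hX fun K _ ε hε => ⟨0, ?_, fun x _ => ?_⟩
    · unfold IsFiniteRank; infer_instance
    · rwa [Subsingleton.elim ((0 : X →L[ℝ] X) x - x) 0, norm_zero]
  simp only [HasAP, not_forall] at hX
  obtain ⟨K, hK, hKX⟩ := hX
  obtain ⟨z, hz, hKz⟩ := hK.exists_null_seq_subset_closure_convexHull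
  obtain ⟨M, hM⟩ := hz.bddAbove_range
  rw [mem_upperBounds, forall_mem_range] at hM
  have hM0 : 0 ≤ M := (norm_nonneg _).trans (hM 0)
  set c : ℝ := (M + 1)⁻¹ with hc
  have hcpos : 0 < c := by positivity
  obtain ⟨a, ha⟩ := exists_nullSeq_range_subset_hull (z := fun n => c • z n)
    (fun n => by
      rw [norm_smul, Real.norm_of_nonneg hcpos.le, hc, inv_mul_le_iff₀ (by positivity)]
      linarith [hM n])
    (by simpa [norm_smul] using hz.const_mul ‖c‖)
  refine ⟨a, fun H => hKX fun ε hε => ?_⟩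
  -- The factor `c` moves the null sequence into the unit ball; by linearity an error `c * ε` on the
  -- hull becomes `ε` on `K`.
  have hsub : K ⊆ (fun x : X => c • x) ⁻¹' a.hull := by
    refine hKz.trans (closure_minimal (convexHull_min ?_ ?_) ?_)
    · exact range_subset_iff.2 fun n => ha ⟨n, rfl⟩
    · exact a.convex_hull.is_linear_preimage (IsLinearMap.isLinearMap_smul c)
    · exact a.isClosed_hull.preimage (continuous_const_smul c)
  obtain ⟨T, hT, hTx⟩ := H (c * ε) (by positivity)
  refine ⟨T, hT, fun x hx => ?_⟩
  have h := hTx _ (hsub hx)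
  simp only [map_smul] at h
  rw [← smul_sub, norm_smul, Real.norm_of_nonneg hcpos.le] at h
  exact lt_of_mul_lt_mul_left h hcpos.le

end NullSequences

end Willis

namespace Willis

/-! ### Approximating functionals on compact sets -/

section DualApproximation

variable {E X : Type*} [NormedAddCommGroup E] [NormedSpace ℝ E]
  [NormedAddCommGroup X] [NormedSpace ℝ X]

/-- On a compact absolutely convex set, a functional on the domain of an injective operator can be
approximated uniformly by functionals on the codomain. -/
theorem exists_dual_approx {L : E →L[ℝ] X} (hL : Function.Injective L) {C : Set E}
    (hC : IsCompact C) (hC' : AbsConvex ℝ C) (h0 : (0 : E) ∈ C) (φ : E →L[ℝ] ℝ) {δ : ℝ}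
    (hδ : 0 < δ) : ∃ ψ : X →L[ℝ] ℝ, ∀ y ∈ C, |ψ (L y) - φ y| < δ := by
  -- As `L` is injective, the image of `C` under `(L, φ)` is a graph over `L '' C`, hence disjoint
  -- from its vertical translate by `δ`. A hyperplane separating the two is the graph of a
  -- functional on `X` close to `φ`.
  set G : E →L[ℝ] X × ℝ := L.prod φ with hG
  have hGc : IsCompact (G '' C) := hC.image G.continuous
  have hGconv : Convex ℝ (G '' C) := hC'.2.linear_image (G : E →ₗ[ℝ] X × ℝ)
  have hdisj : Disjoint (G '' C) ((fun p => p + ((0 : X), δ)) '' (G '' C)) := by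
    rw [Set.disjoint_left]
    rintro _ ⟨x, -, rfl⟩ ⟨_, ⟨y, -, rfl⟩, hxy⟩
    have h1 : L y + 0 = L x := congrArg Prod.fst hxy
    have h2 : φ y + δ = φ x := congrArg Prod.snd hxy
    rw [add_zero] at h1
    rw [hL h1] at h2
    linarith
  obtain ⟨f, u, v, hu, huv, hv⟩ := geometric_hahn_banach_compact_closed hGconv hGc
    (by simpa [add_comm] using hGconv.translate ((0 : X), δ))
    (hGc.image (continuous_id.add continuous_const)).isClosed hdisj
  set g : X →L[ℝ] ℝ := f.comp (ContinuousLinearMap.inl ℝ X ℝ) with hg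
  set c : ℝ := f (0, 1) with hc
  have hf : ∀ x r, f (x, r) = g x + r * c := by
    intro x r
    have h : ((x, r) : X × ℝ) = (x, 0) + r • ((0 : X), (1 : ℝ)) := by simp
    rw [h, map_add, map_smul]
    rfl
  have key : ∀ x ∈ C, ∀ y ∈ C, g (L x) + φ x * c < g (L y) + (φ y + δ) * c := by
    intro x hx y hy
    have h1 := hu _ ⟨x, hx, rfl⟩
    have h2 := hv _ ⟨_, ⟨y, hy, rfl⟩, rfl⟩
    have h3 : G x = (L x, φ x) := rfl
    have h4 : G y + ((0 : X), δ) = (L y, φ y + δ) := by simp [hG]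
    rw [h3, hf] at h1
    change v < f (G y + ((0 : X), δ)) at h2
    rw [h4, hf] at h2
    linarith
  -- The separation at the origin reads `0 < δ * c`, so the hyperplane is not vertical.
  have hcpos : 0 < c := by
    have h := key 0 h0 0 h0
    simp only [map_zero, zero_mul, zero_add] at h
    exact pos_of_mul_pos_right h hδ.le
  refine ⟨-(c⁻¹ • g), fun y hy => ?_⟩
  -- Comparing `y` and `-y` with `0` bounds `g (L y) + φ y * c` on both sides by `δ * c`.
  have h1 := key y hy 0 h0
  have h2 := key (-y) (hC'.1.neg_mem_iff.2 hy) 0 h0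
  simp only [map_zero, zero_add, map_neg] at h1 h2
  have h3 : (-(c⁻¹ • g)) (L y) - φ y = -((g (L y) + φ y * c) / c) := by
    simp only [neg_apply, smul_apply, smul_eq_mul]
    field_simp
    ring
  rw [h3, abs_neg, abs_div, abs_of_pos hcpos, div_lt_iff₀ hcpos, abs_lt]
  constructor <;> linarith

end DualApproximation

/-! ### The Banach spaces `Y_t` and their compact inclusions -/

variable {X : Type*} [NormedAddCommGroup X] [NormedSpace ℝ X]

namespace NullSeq

variable (a : NullSeq X)

theorem isClosed_U (t : ℝ) : IsClosed (a.U t) := isClosed_closure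

/-- Because `U_t` is closed, the infimum in the gauge is attained; thus the closed unit ball of
`Y_t` is exactly `U_t`. -/
theorem mem_smul_U_of_gauge_le {t r : ℝ} (hr : 0 < r) {x : X} (hx : x ∈ a.spanU t)
    (h : gauge (a.U t) x ≤ r) : x ∈ r • a.U t := by
  rw [mem_smul_set_iff_inv_smul_mem₀ hr.ne']
  have hs : ∀ s, r < s → s⁻¹ • x ∈ a.U t := by
    intro s hs
    obtain ⟨r', hr', hx'⟩ :=
      exists_mem_smul_of_mem_span (a.absConvex_U t) (a.zero_mem_U t) hx
    have hne : {c ∈ Ioi (0 : ℝ) | x ∈ c • a.U t}.Nonempty := ⟨r', hr', hx'⟩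
    obtain ⟨b, ⟨hb0, hb⟩, hbs⟩ := exists_lt_of_csInf_lt hne (h.trans_lt hs)
    rw [← mem_smul_set_iff_inv_smul_mem₀ (hr.trans hs).ne']
    refine (a.absConvex_U t).1.smul_mono (a := b) ?_ hb
    rw [Real.norm_of_nonneg (mem_Ioi.1 hb0).le, Real.norm_of_nonneg (hr.trans hs).le]
    exact hbs.le
  have hlim : Tendsto (fun s : ℝ => s⁻¹ • x) (𝓝[>] r) (𝓝 (r⁻¹ • x)) :=
    ((continuousAt_inv₀ hr.ne').smul continuousAt_const).tendsto.mono_left nhdsWithin_le_nhds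
  exact (a.isClosed_U t).mem_of_tendsto hlim (eventually_mem_nhdsWithin.mono hs)

theorem norm_le_iff {t : Ioo (0 : ℝ) 1} (y : a.Y t) {r : ℝ} (hr : 0 < r) :
    ‖y‖ ≤ r ↔ a.incl t y ∈ r • a.U t :=
  ⟨fun h => a.mem_smul_U_of_gauge_le hr y.2 h, fun h => gauge_le_of_mem hr.le h⟩

/-- An element of the span of `U_t`, regarded as an element of `Y_t`. -/
def toY (t : Ioo (0 : ℝ) 1) (x : X) (hx : x ∈ a.spanU t) : a.Y t := ⟨x, hx⟩

theorem incl_toY (t : Ioo (0 : ℝ) 1) {x : X} (hx : x ∈ a.spanU t) :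
    a.incl t (a.toY t x hx) = x := rfl

theorem incl_mem (t : Ioo (0 : ℝ) 1) (y : a.Y t) : a.incl t y ∈ a.spanU t := y.2

theorem incl_injective (t : Ioo (0 : ℝ) 1) : Function.Injective (a.incl t) :=
  fun _ _ h => Subtype.ext h

theorem L_apply (t : Ioo (0 : ℝ) 1) (y : a.Y t) : a.L t y = a.incl t y := rfl

theorem L_injective (t : Ioo (0 : ℝ) 1) : Function.Injective (a.L t) :=
  a.incl_injective t

instance completeSpace_Y [CompleteSpace X] (t : Ioo (0 : ℝ) 1) : CompleteSpace (a.Y t) := by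
  refine Metric.complete_of_cauchySeq_tendsto fun u hu => ?_
  obtain ⟨x, hx⟩ := cauchySeq_tendsto_of_complete ((a.L t).uniformContinuous.comp_cauchySeq hu)
  -- The balls `ε • U_t` of `Y_t` are closed in `X`, so the Cauchy estimate survives the passage to
  -- the limit in `X`.
  have key : ∀ ε : ℝ, 0 < ε → ∃ N, ∀ n, N ≤ n → a.L t (u n) - x ∈ ε • a.U t := by
    intro ε hε
    obtain ⟨N, hN⟩ := Metric.cauchySeq_iff.1 hu ε hε
    refine ⟨N, fun n hn => ?_⟩
    refine ((a.isClosed_U t).smul_of_ne_zero hε.ne').mem_of_tendsto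
      (hx.const_sub (a.L t (u n))) (eventually_atTop.2 ⟨N, fun m hm => ?_⟩)
    have h := hN n hn m hm
    rw [dist_eq_norm] at h
    have h2 := (a.norm_le_iff _ hε).1 h.le
    rwa [map_sub] at h2
  have hspan : ∀ ε : ℝ, ∀ z ∈ ε • a.U t, z ∈ a.spanU t := by
    rintro ε _ ⟨z, hz, rfl⟩
    exact Submodule.smul_mem _ _ (Submodule.subset_span hz)
  have hxs : x ∈ a.spanU t := by
    obtain ⟨N, hN⟩ := key 1 one_pos
    have h := Submodule.sub_mem _ (a.incl_mem t (u N)) (hspan _ _ (hN N le_rfl))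
    rwa [L_apply, sub_sub_cancel] at h
  refine ⟨a.toY t x hxs, ?_⟩
  rw [tendsto_iff_norm_sub_tendsto_zero, Metric.tendsto_atTop]
  intro ε hε
  obtain ⟨N, hN⟩ := key (ε / 2) (half_pos hε)
  refine ⟨N, fun n hn => ?_⟩
  rw [Real.dist_0_eq_abs, abs_norm]
  refine lt_of_le_of_lt ((a.norm_le_iff _ (half_pos hε)).2 ?_) (half_lt_self hε)
  rw [map_sub, incl_toY]
  exact hN n hn

theorem scaled_eq_smul (s t : ℝ) (n : ℕ) :
    a.scaled s n = (‖a.seq n‖ ^ (t - s)) • a.scaled t n := by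
  by_cases h0 : a.seq n = 0
  · simp [scaled, h0]
  have hpos : 0 < ‖a.seq n‖ := norm_pos_iff.2 h0
  rw [scaled, scaled, smul_smul, ← Real.rpow_neg hpos.le, ← Real.rpow_neg hpos.le,
    ← Real.rpow_add hpos]
  congr 2
  ring

theorem scaled_zero (n : ℕ) : a.scaled 0 n = a.seq n := by
  rw [scaled, Real.rpow_zero, inv_one, one_smul]

theorem scaled_mem_U (t : ℝ) (n : ℕ) : a.scaled t n ∈ a.U t := a.subset_U t (Or.inl ⟨n, rfl⟩)

/-- The vectors `x_n / ‖x_n‖ ^ s` as elements of `Y_t`, for `s ≤ t`. -/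
noncomputable def scaledIn {s : ℝ} {t : Ioo (0 : ℝ) 1} (h : s ≤ t) (n : ℕ) : a.Y t :=
  a.toY t (a.scaled s n) (a.spanU_mono h (Submodule.subset_span (a.scaled_mem_U s n)))

theorem incl_scaledIn {s : ℝ} {t : Ioo (0 : ℝ) 1} (h : s ≤ t) (n : ℕ) :
    a.incl t (a.scaledIn h n) = a.scaled s n := a.incl_toY t _

theorem norm_scaledIn_le {s : ℝ} {t : Ioo (0 : ℝ) 1} (h : s ≤ t) (n : ℕ) :
    ‖a.scaledIn h n‖ ≤ ‖a.seq n‖ ^ (t - s) := by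
  refine gauge_le_of_mem (Real.rpow_nonneg (norm_nonneg _) _) ?_
  rw [incl_scaledIn, a.scaled_eq_smul s t]
  exact smul_mem_smul_set (a.scaled_mem_U t n)

/-- The strict inequality makes `‖x_n‖ ^ (t - s)` tend to `0`. The real parameter `s` may be `0`,
which gives the `x_n` themselves. -/
theorem tendsto_scaledIn {s : ℝ} {t : Ioo (0 : ℝ) 1} (h : s < t) :
    Tendsto (a.scaledIn h.le) atTop (𝓝 0) := by
  rw [tendsto_zero_iff_norm_tendsto_zero]
  refine squeeze_zero (fun _ => norm_nonneg _) (a.norm_scaledIn_le h.le) ?_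
  have h2 := a.tendsto_norm.rpow_const (p := (t : ℝ) - s) (Or.inr (by linarith))
  rwa [Real.zero_rpow (by linarith)] at h2

/-- The closed absolutely convex hull in `Y_t` of the vectors `x_n / ‖x_n‖ ^ s`. -/
def hullIn {s : ℝ} {t : Ioo (0 : ℝ) 1} (h : s ≤ t) : Set (a.Y t) :=
  closedAbsConvexHull ℝ (range (a.scaledIn h))

theorem scaledIn_mem_hullIn {s : ℝ} {t : Ioo (0 : ℝ) 1} (h : s ≤ t) (n : ℕ) :
    a.scaledIn h n ∈ a.hullIn h :=
  subset_closedAbsConvexHull ⟨n, rfl⟩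

theorem absConvex_hullIn {s : ℝ} {t : Ioo (0 : ℝ) 1} (h : s ≤ t) : AbsConvex ℝ (a.hullIn h) :=
  absConvex_convexClosedHull

theorem isCompact_hullIn [CompleteSpace X] {s : ℝ} {t : Ioo (0 : ℝ) 1} (h : s < t) :
    IsCompact (a.hullIn h.le) :=
  isCompact_closedAbsConvexHull_of_totallyBounded
    ((a.tendsto_scaledIn h).isCompact_insert_range.totallyBounded.subset (subset_insert _ _))

/-- The hull formed in `Y_t` is compact, so its image is closed in `X` and already absorbs the
closure taken there. -/
theorem U_subset_image_hullIn [CompleteSpace X] {s : ℝ} {t : Ioo (0 : ℝ) 1} (h : s < t) :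
    a.U s ⊆ a.L t '' a.hullIn h.le := by
  refine a.U_subset ⟨?_, ?_⟩ ((a.isCompact_hullIn h).image (a.L t).continuous).isClosed
    fun n => ⟨_, a.scaledIn_mem_hullIn h.le n, rfl⟩
  · intro c hc
    rintro _ ⟨_, ⟨y, hy, rfl⟩, rfl⟩
    exact ⟨c • y, (a.absConvex_hullIn h.le).1.smul_mem hc hy, map_smul _ _ _⟩
  · exact (a.absConvex_hullIn h.le).2.linear_image (a.L t : a.Y t →ₗ[ℝ] X)

/-- The inclusion of `Y_s` in `Y_t`, for `s ≤ t`, as a linear map. -/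
noncomputable def inclInLinear {s t : Ioo (0 : ℝ) 1} (h : s ≤ t) : a.Y s →ₗ[ℝ] a.Y t where
  toFun y := a.toY t (a.incl s y) (a.spanU_mono h (a.incl_mem s y))
  map_add' x y := by
    apply a.incl_injective t
    refine (a.incl_toY t _).trans ?_
    rw [map_add, map_add, a.incl_toY, a.incl_toY]
  map_smul' c y := by
    apply a.incl_injective t
    refine (a.incl_toY t _).trans ?_
    rw [map_smul, map_smul, a.incl_toY, RingHom.id_apply]

theorem inclInLinear_apply {s t : Ioo (0 : ℝ) 1} (h : s ≤ t) (y : a.Y s) :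
    a.inclInLinear h y = a.toY t (a.incl s y) (a.spanU_mono h (a.incl_mem s y)) := rfl

theorem incl_inclInLinear {s t : Ioo (0 : ℝ) 1} (h : s ≤ t) (y : a.Y s) :
    a.incl t (a.inclInLinear h y) = a.incl s y := by
  rw [inclInLinear_apply, incl_toY]

/-- The inclusion of `Y_s` in `Y_t`, for `s ≤ t`, as a bounded operator. -/
noncomputable def inclIn {s t : Ioo (0 : ℝ) 1} (h : s ≤ t) : a.Y s →L[ℝ] a.Y t :=
  (a.inclInLinear h).mkContinuous 1 fun y => by
    rw [one_mul, a.norm_def, a.norm_def, a.incl_inclInLinear]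
    exact gauge_anti_of_mem_span (a.absConvex_U s) (a.zero_mem_U s) (a.U_mono h) (a.incl_mem s y)

theorem incl_inclIn {s t : Ioo (0 : ℝ) 1} (h : s ≤ t) (y : a.Y s) :
    a.incl t (a.inclIn h y) = a.incl s y :=
  a.incl_inclInLinear h y

theorem isCompactOperator_inclIn [CompleteSpace X] {s t : Ioo (0 : ℝ) 1} (h : s < t) :
    IsCompactOperator (a.inclIn h.le) := by
  rw [isCompactOperator_iff_exists_mem_nhds_image_subset_compact]
  refine ⟨Metric.closedBall 0 1, Metric.closedBall_mem_nhds _ one_pos, a.hullIn (s := s) h.le,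
    a.isCompact_hullIn h, ?_⟩
  rintro _ ⟨y, hy, rfl⟩
  rw [mem_closedBall_zero_iff, a.norm_le_iff y one_pos, one_smul] at hy
  obtain ⟨z, hz, hzy⟩ := a.U_subset_image_hullIn (t := t) h hy
  have h2 : a.L t z = a.L t (a.inclIn h.le y) := by
    rw [hzy, L_apply, incl_inclIn]
  rwa [← a.L_injective t h2]

/-- If the inclusion of `Y_t` in `X` is a limit of operators of finite rank, then the identity of
`X` is approximable on the hull of the sequence. -/
theorem idApproximableOn_hull [CompleteSpace X] {t : Ioo (0 : ℝ) 1}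
    (H : FiniteRankApproximable (a.L t)) : IdApproximableOn a.hull := by
  intro ε hε
  obtain ⟨S, hS, hLS⟩ := H (ε / 3) (by positivity)
  set F := LinearMap.range (S : a.Y t →ₗ[ℝ] X) with hF
  have : FiniteDimensional ℝ F := hS
  let b := Module.finBasis ℝ F
  let S' : a.Y t →L[ℝ] F := S.codRestrict F fun y => ⟨y, rfl⟩
  let φ := fun i => (LinearMap.toContinuousLinearMap (b.coord i)).comp S'
  have hSφ : ∀ y, S y = ∑ i, φ i y • (b i : X) := by
    intro y
    have h := congrArg (Subtype.val) (b.sum_repr (S' y))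
    rw [Submodule.coe_sum] at h
    exact h.symm
  have hB : 0 ≤ ∑ i, ‖(b i : X)‖ := Finset.sum_nonneg fun _ _ => norm_nonneg _
  set B := ∑ i, ‖(b i : X)‖ with hBdef
  have ht : (0 : ℝ) < t := t.2.1
  have h0 : (0 : a.Y t) ∈ a.hullIn ht.le :=
    (a.absConvex_hullIn ht.le).1.zero_mem ⟨_, a.scaledIn_mem_hullIn ht.le 0⟩
  -- The coordinate functionals `φ i` are continuous only on `Y_t`. They are replaced on the compact
  -- hull of the `x_n` (the case `s = 0`), with a tolerance that makes the total error at most `ε /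
  -- 3`.
  choose ψ hψ using fun i => exists_dual_approx (a.L_injective t) (a.isCompact_hullIn ht)
    (a.absConvex_hullIn ht.le) h0 (φ i) (δ := ε / 3 / (B + 1)) (by positivity)
  let T : X →L[ℝ] X := ∑ i, (ψ i).smulRight (b i : X)
  have hT : ∀ x, T x = ∑ i, ψ i x • (b i : X) := fun x => by
    simp [T]
  have hseq : ∀ n, ‖T (a.seq n) - a.seq n‖ ≤ 2 * ε / 3 := by
    intro n
    set y := a.scaledIn ht.le n with hy
    have hLy : a.L t y = a.seq n := a.scaled_zero n
    have hyn : ‖y‖ ≤ 1 := (a.norm_scaledIn_le ht.le n).trans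
      (Real.rpow_le_one (norm_nonneg _) (a.norm_le_one n) (by linarith))
    have h1 : ‖T (a.seq n) - S y‖ ≤ ε / 3 := by
      rw [hT, hSφ, ← Finset.sum_sub_distrib]
      calc ‖∑ i, (ψ i (a.seq n) • (b i : X) - φ i y • (b i : X))‖
          ≤ ∑ i, ε / 3 / (B + 1) * ‖(b i : X)‖ := by
            refine norm_sum_le_of_le _ fun i _ => ?_
            rw [← sub_smul, norm_smul]
            refine mul_le_mul_of_nonneg_right ?_ (norm_nonneg _)
            have h := hψ i y (a.scaledIn_mem_hullIn ht.le n)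
            rw [hLy] at h
            exact h.le
        _ = ε / 3 / (B + 1) * B := by rw [← Finset.mul_sum]
        _ ≤ ε / 3 := by
            rw [div_mul_eq_mul_div, div_le_iff₀ (by positivity)]
            nlinarith
    have h2 : ‖a.L t y - S y‖ ≤ ε / 3 := by
      have h := ((a.L t - S).le_opNorm y).trans
        (mul_le_mul hLS.le hyn (norm_nonneg _) (by positivity))
      rwa [mul_one] at h
    rw [hLy] at h2
    calc ‖T (a.seq n) - a.seq n‖ = ‖(T (a.seq n) - S y) - (a.seq n - S y)‖ := by
          rw [sub_sub_sub_cancel_right]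
      _ ≤ ‖T (a.seq n) - S y‖ + ‖a.seq n - S y‖ := norm_sub_le _ _
      _ ≤ 2 * ε / 3 := by linarith
  refine ⟨T, ?_, fun x hx => ?_⟩
  · refine Submodule.finiteDimensional_of_le (S₂ := F) ?_
    rintro _ ⟨x, rfl⟩
    change T x ∈ F
    rw [hT]
    exact Submodule.sum_mem _ fun i _ => Submodule.smul_mem _ _ (b i).2
  -- The bound at the points `x_n` extends to `K`, because it defines a closed convex set.
  · have hsub : a.hull ⊆ (T - ContinuousLinearMap.id ℝ X) ⁻¹' Metric.closedBall 0 (2 * ε / 3) := by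
      refine closure_minimal (convexHull_min (range_subset_iff.2 fun n => ?_) ?_) ?_
      · simpa using hseq n
      · exact (convex_closedBall _ _).linear_preimage
          ((T - ContinuousLinearMap.id ℝ X : X →L[ℝ] X) : X →ₗ[ℝ] X)
      · exact Metric.isClosed_closedBall.preimage (ContinuousLinearMap.continuous _)
    have h := hsub hx
    rw [mem_preimage, mem_closedBall_zero_iff] at h
    exact lt_of_le_of_lt h (by linarith)

end NullSeq

end Willis

namespace Willis

/-! ### Finite-rank approximation and compact operators -/

section FiniteRank

variable {E F G : Type*} [NormedAddCommGroup E] [NormedSpace ℝ E] [NormedAddCommGroup F]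
  [NormedSpace ℝ F] [NormedAddCommGroup G] [NormedSpace ℝ G]

theorem IsFiniteRank.comp_right {S : F →L[ℝ] G} (hS : IsFiniteRank S) (T : E →L[ℝ] F) :
    IsFiniteRank (S ∘L T) := by
  have : FiniteDimensional ℝ (LinearMap.range (S : F →ₗ[ℝ] G)) := hS
  exact Submodule.finiteDimensional_of_le
    (LinearMap.range_comp_le_range (T : E →ₗ[ℝ] F) (S : F →ₗ[ℝ] G))

theorem IsFiniteRank.comp_left {S : E →L[ℝ] F} (hS : IsFiniteRank S) (T : F →L[ℝ] G) :
    IsFiniteRank (T ∘L S) := by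
  have : FiniteDimensional ℝ (LinearMap.range (S : E →ₗ[ℝ] F)) := hS
  change FiniteDimensional ℝ (LinearMap.range ((T : F →ₗ[ℝ] G) ∘ₗ (S : E →ₗ[ℝ] F)))
  rw [LinearMap.range_comp]
  infer_instance

theorem FiniteRankApproximable.comp_left {R : E →L[ℝ] F} (hR : FiniteRankApproximable R)
    (T : F →L[ℝ] G) : FiniteRankApproximable (T ∘L R) := by
  intro ε hε
  obtain ⟨S, hS, hRS⟩ := hR (ε / (‖T‖ + 1)) (by positivity)
  refine ⟨T ∘L S, hS.comp_left T, ?_⟩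
  rw [← ContinuousLinearMap.comp_sub]
  rw [lt_div_iff₀ (by positivity)] at hRS
  refine (T.opNorm_comp_le (R - S)).trans_lt ?_
  nlinarith [norm_nonneg (R - S)]

/-- A compact operator into a space with the approximation property is a limit of operators of
finite rank. -/
theorem HasAP.finiteRankApproximable (hF : HasAP F) {R : E →L[ℝ] F} (hR : IsCompactOperator R) :
    FiniteRankApproximable R := by
  intro ε hε
  have hK : IsCompact (closure (R '' Metric.closedBall 0 1)) :=
    IsCompactOperator.isCompact_closure_image_closedBall (f := (R : E →ₗ[ℝ] F)) hR 1
  obtain ⟨T, hT, hTK⟩ := hF _ hK (ε / 2) (half_pos hε)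
  refine ⟨T ∘L R, hT.comp_right R, ?_⟩
  refine lt_of_le_of_lt ?_ (half_lt_self hε)
  refine ContinuousLinearMap.opNorm_le_of_unit_norm (half_pos hε).le fun x hx => ?_
  have h := hTK (R x) (subset_closure ⟨x, mem_closedBall_zero_iff.2 hx.le, rfl⟩)
  rw [norm_sub_rev] at h
  exact h.le

end FiniteRank

/-! ### The space `Z`: integration and step operators -/

variable {X : Type*} [NormedAddCommGroup X] [NormedSpace ℝ X]

namespace NullSeq

variable (a : NullSeq X)

theorem toFun_injective : Function.Injective a.toFun := fun _ _ h => Subtype.ext h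

/-- `U_r` lies in the unit ball of `X`. This domination makes step functions integrable in `X` and
integration contractive for the norm of `Z`. -/
theorem norm_toFun_le (f : a.ZStep) {r : ℝ} (hr : r ∈ Ioo (0 : ℝ) 1) :
    ‖a.toFun f r‖ ≤ gauge (a.U r) (a.toFun f r) :=
  norm_le_gauge (a.absConvex_U r) (a.zero_mem_U r) (a.U_subset_closedBall hr.2.le)
    (a.spanSteps_apply_mem f.2 r)

theorem integrableOn_toFun (f : a.ZStep) : IntegrableOn (a.toFun f) (Ioo 0 1) := by
  obtain ⟨F, hF⟩ := a.exists_simpleFunc f.2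
  refine (a.integrableOn_gauge f.2).mono' ?_
    ((ae_restrict_iff' measurableSet_Ioo).2 (ae_of_all _ fun r hr => a.norm_toFun_le f hr))
  have h : AEStronglyMeasurable (⇑F) (volume.restrict (Ioo (0 : ℝ) 1)) := F.aestronglyMeasurable
  rwa [hF] at h

/-- Integration of step functions, as a linear map. -/
noncomputable def integralLinear : a.ZStep →ₗ[ℝ] X where
  toFun f := ∫ r in Ioo (0 : ℝ) 1, a.toFun f r
  map_add' f g := by
    rw [map_add]
    exact integral_add (a.integrableOn_toFun f) (a.integrableOn_toFun g)
  map_smul' c f := by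
    rw [map_smul]
    exact integral_smul c _

theorem norm_integralLinear_le (f : a.ZStep) : ‖a.integralLinear f‖ ≤ ‖f‖ :=
  norm_integral_le_of_norm_le (a.integrableOn_gauge f.2)
    ((ae_restrict_iff' measurableSet_Ioo).2 (ae_of_all _ fun _ hr => a.norm_toFun_le f hr))

/-- Integration as a bounded operator from `Z` to `X`. -/
noncomputable def J [CompleteSpace X] : a.Z →L[ℝ] X :=
  a.integralLinear.extendOfNorm
    ((UniformSpace.Completion.toComplL : a.ZStep →L[ℝ] a.Z) : a.ZStep →ₗ[ℝ] a.Z)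

theorem J_coe [CompleteSpace X] (f : a.ZStep) :
    a.J (f : a.Z) = ∫ r in Ioo (0 : ℝ) 1, a.toFun f r := by
  refine LinearMap.extendOfNorm_eq (f := a.integralLinear)
    (e := ((UniformSpace.Completion.toComplL : a.ZStep →L[ℝ] a.Z) : a.ZStep →ₗ[ℝ] a.Z))
    UniformSpace.Completion.denseRange_coe ⟨1, fun g => ?_⟩ f
  rw [one_mul]
  exact (a.norm_integralLinear_le g).trans_eq (UniformSpace.Completion.norm_coe g).symm

/-- The step function `y χ_(s,1)`, for `y ∈ Y_s`. -/
noncomputable def stepFun (s : Ioo (0 : ℝ) 1) (y : a.Y s) : a.ZStep :=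
  ⟨(Ioo (s : ℝ) 1).indicator fun _ => a.incl s y,
    Submodule.subset_span ⟨s, 1, a.incl s y, s.2.1, s.2.2, le_rfl, a.incl_mem s y, rfl⟩⟩

theorem toFun_stepFun (s : Ioo (0 : ℝ) 1) (y : a.Y s) :
    a.toFun (a.stepFun s y) = (Ioo (s : ℝ) 1).indicator fun _ => a.incl s y := rfl

/-- The step function `y χ_(s,1)` as a linear function of `y ∈ Y_s`. -/
noncomputable def stepLinear (s : Ioo (0 : ℝ) 1) : a.Y s →ₗ[ℝ] a.ZStep where
  toFun y := a.stepFun s y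
  map_add' x y := by
    refine a.toFun_injective ?_
    rw [map_add a.toFun, toFun_stepFun, toFun_stepFun, toFun_stepFun, map_add,
      ← indicator_add']
    rfl
  map_smul' c y := by
    refine a.toFun_injective ?_
    rw [map_smul a.toFun, toFun_stepFun, toFun_stepFun, map_smul, RingHom.id_apply]
    exact indicator_const_smul _ c _

theorem toFun_stepLinear (s : Ioo (0 : ℝ) 1) (y : a.Y s) :
    a.toFun (a.stepLinear s y) = (Ioo (s : ℝ) 1).indicator fun _ => a.incl s y := rfl

/-- The interval is half-open because `χ_(s,1) - χ_(t,1)` is `χ_(s,t]` on `(0,1)`. -/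
theorem norm_step_le {f : a.ZStep} {s t c : ℝ} (hst : s ≤ t) (hc : 0 ≤ c)
    (h : ∀ r ∈ Ioo (0 : ℝ) 1, gauge (a.U r) (a.toFun f r) ≤ (Ioc s t).indicator (fun _ => c) r) :
    ‖f‖ ≤ (t - s) * c := by
  have hi : Integrable ((Ioc s t).indicator fun _ : ℝ => c) :=
    (integrable_indicator_iff measurableSet_Ioc).2 (integrableOn_const (by simp))
  have h0 : ∀ r, 0 ≤ (Ioc s t).indicator (fun _ : ℝ => c) r :=
    indicator_nonneg fun _ _ => hc
  calc ‖f‖ = ∫ r in Ioo (0 : ℝ) 1, gauge (a.U r) (a.toFun f r) := a.normZ_def f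
    _ ≤ ∫ r in Ioo (0 : ℝ) 1, (Ioc s t).indicator (fun _ => c) r :=
        setIntegral_mono_on (a.integrableOn_gauge f.2) hi.integrableOn measurableSet_Ioo h
    _ ≤ ∫ r, (Ioc s t).indicator (fun _ => c) r :=
        setIntegral_le_integral hi (ae_of_all _ h0)
    _ = (t - s) * c := by
        rw [integral_indicator measurableSet_Ioc, setIntegral_const,
          Real.volume_real_Ioc_of_le hst, smul_eq_mul]

theorem gauge_incl_le {s : Ioo (0 : ℝ) 1} {r : ℝ} (h : s ≤ r) (y : a.Y s) :
    gauge (a.U r) (a.incl s y) ≤ ‖y‖ :=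
  gauge_anti_of_mem_span (a.absConvex_U s) (a.zero_mem_U s) (a.U_mono h) (a.incl_mem s y)

theorem norm_stepLinear_le (s : Ioo (0 : ℝ) 1) (y : a.Y s) : ‖a.stepLinear s y‖ ≤ ‖y‖ := by
  refine (a.norm_step_le (s := 0) (t := 1) zero_le_one (norm_nonneg y) fun r hr => ?_).trans_eq
    (by ring)
  rw [indicator_of_mem (Ioo_subset_Ioc_self hr), toFun_stepLinear]
  by_cases h : r ∈ Ioo (s : ℝ) 1
  · rw [indicator_of_mem h]
    exact a.gauge_incl_le h.1.le y
  · rw [indicator_of_notMem h, gauge_zero]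
    exact norm_nonneg y

/-- The difference is `y χ_(s,t]`, and `|||y|||_r ≤ |||y|||_s` for `r ≥ s`. -/
theorem norm_stepLinear_sub_le {s t : Ioo (0 : ℝ) 1} (h : s ≤ t) (y : a.Y s) :
    ‖a.stepLinear s y - a.stepLinear t (a.inclIn h y)‖ ≤ (t - s) * ‖y‖ := by
  have hst : (s : ℝ) ≤ t := h
  refine a.norm_step_le hst (norm_nonneg y) fun r hr => ?_
  rw [map_sub, Pi.sub_apply, toFun_stepLinear, toFun_stepLinear, incl_inclIn]
  by_cases hs : (s : ℝ) < r
  · rw [indicator_of_mem (mem_Ioo.2 ⟨hs, hr.2⟩)]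
    by_cases ht : (t : ℝ) < r
    · rw [indicator_of_mem (mem_Ioo.2 ⟨ht, hr.2⟩), sub_self, gauge_zero]
      exact indicator_nonneg (fun _ _ => norm_nonneg y) r
    · rw [indicator_of_notMem fun h => ht h.1, sub_zero,
        indicator_of_mem (mem_Ioc.2 ⟨hs, not_lt.1 ht⟩)]
      exact a.gauge_incl_le hs.le y
  · have ht : ¬ (t : ℝ) < r := fun h => hs (hst.trans_lt h)
    rw [indicator_of_notMem fun h => hs h.1, indicator_of_notMem fun h => ht h.1, sub_self,
      gauge_zero]
    exact indicator_nonneg (fun _ _ => norm_nonneg y) r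

/-- The map `y ↦ y χ_(s,1)` as a bounded operator from `Y_s` to `Z`. -/
noncomputable def step (s : Ioo (0 : ℝ) 1) : a.Y s →L[ℝ] a.Z :=
  (UniformSpace.Completion.toComplL : a.ZStep →L[ℝ] a.Z) ∘L
    (a.stepLinear s).mkContinuous 1 fun y => (a.norm_stepLinear_le s y).trans_eq (one_mul _).symm

theorem step_apply (s : Ioo (0 : ℝ) 1) (y : a.Y s) :
    a.step s y = ((a.stepLinear s y : a.ZStep) : a.Z) := rfl

theorem norm_step_sub_le {s t : Ioo (0 : ℝ) 1} (h : s ≤ t) :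
    ‖a.step s - a.step t ∘L a.inclIn h‖ ≤ t - s := by
  have hst : (s : ℝ) ≤ t := h
  refine ContinuousLinearMap.opNorm_le_bound _ (sub_nonneg.2 hst) fun y => ?_
  rw [sub_apply, ContinuousLinearMap.comp_apply, step_apply, step_apply,
    ← UniformSpace.Completion.coe_sub, UniformSpace.Completion.norm_coe]
  exact a.norm_stepLinear_sub_le h y

/-- Compact operators form a norm-closed set, and `a.step s` is the limit, as `t` decreases to `s`,
of operators factoring through the compact inclusions `Y_s → Y_t`. -/
theorem isCompactOperator_step [CompleteSpace X] (s : Ioo (0 : ℝ) 1) :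
    IsCompactOperator (a.step s) := by
  have hcl : IsClosed {T : a.Y s →L[ℝ] a.Z | IsCompactOperator T} :=
    isClosed_setOfPred_isCompactOperator
  refine hcl.closure_subset (Metric.mem_closure_iff.2 fun ε hε => ?_)
  have hs1 : (0 : ℝ) < 1 - s := sub_pos.2 s.2.2
  have hmin : 0 < min (ε / 2) ((1 - s) / 2 : ℝ) := lt_min (half_pos hε) (half_pos hs1)
  -- Close enough to `s` for an error below `ε`, yet still less than `1`.
  let t : Ioo (0 : ℝ) 1 := ⟨s + min (ε / 2) ((1 - s) / 2), by
    linarith [s.2.1], by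
    linarith [min_le_right (ε / 2) ((1 - s) / 2 : ℝ)]⟩
  have hst : s < t := Subtype.coe_lt_coe.1 (lt_add_of_pos_right _ hmin)
  refine ⟨a.step t ∘L a.inclIn hst.le,
    (a.isCompactOperator_inclIn hst).clm_comp (a.step t), ?_⟩
  rw [dist_eq_norm]
  refine (a.norm_step_sub_le hst.le).trans_lt ?_
  have h : (t : ℝ) - s = min (ε / 2) ((1 - s) / 2) := add_sub_cancel_left _ _
  rw [h]
  exact (min_le_left _ _).trans_lt (half_lt_self hε)

theorem J_step [CompleteSpace X] (s : Ioo (0 : ℝ) 1) (y : a.Y s) :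
    a.J (a.step s y) = (1 - s : ℝ) • a.incl s y := by
  rw [step_apply, J_coe, toFun_stepLinear, setIntegral_indicator measurableSet_Ioo,
    Ioo_inter_Ioo, sup_of_le_right s.2.1.le, inf_idem, setIntegral_const,
    Real.volume_real_Ioo_of_le s.2.2.le]

end NullSeq

end Willis

/-! ### The proposition -/

theorem proposition1 {X : Type*} [NormedAddCommGroup X] [NormedSpace ℝ X] [CompleteSpace X]
    (hX : ¬ Willis.HasAP X) :
    (∃ a : Willis.NullSeq X, ¬ Willis.IdApproximableOn a.hull) ∧
    ∀ a : Willis.NullSeq X, ¬ Willis.IdApproximableOn a.hull →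
      ¬ Willis.HasAP a.Z ∧
      ∃ (R : a.Y Willis.half →L[ℝ] a.Z) (J : a.Z →L[ℝ] X),
        (∀ y : a.Y Willis.half, R y = (((2 : ℝ) • a.halfStep y : a.ZStep) : a.Z)) ∧
        IsCompactOperator R ∧
        (∀ f : a.ZStep, MeasureTheory.IntegrableOn (a.toFun f) (Set.Ioo 0 1) ∧
          J (f : a.Z) = ∫ r in Set.Ioo (0 : ℝ) 1, a.toFun f r) ∧
        J ∘L R = a.L Willis.half ∧
        ¬ Willis.FiniteRankApproximable (a.L Willis.half) ∧
        ¬ Willis.FiniteRankApproximable R := by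
  refine ⟨Willis.exists_nullSeq_not_idApproximableOn hX, fun a ha => ?_⟩
  have hL : ¬ Willis.FiniteRankApproximable (a.L Willis.half) := fun H =>
    ha (a.idApproximableOn_hull H)
  -- The factor `2` compensates for the length of `(1/2, 1)`, so that integration returns `y`
  -- itself.
  set R : a.Y Willis.half →L[ℝ] a.Z := (2 : ℝ) • a.step Willis.half with hR
  have hRc : IsCompactOperator R := (a.isCompactOperator_step Willis.half).smul (2 : ℝ)
  have hJR : a.J ∘L R = a.L Willis.half := by
    ext y
    rw [ContinuousLinearMap.comp_apply, hR, smul_apply, map_smul, a.J_step, smul_smul,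
      a.L_apply]
    have h : (2 : ℝ) * (1 - (Willis.half : ℝ)) = 1 := by
      norm_num [Willis.half]
    rw [h, one_smul]
  have hRn : ¬ Willis.FiniteRankApproximable R := fun H => hL (hJR ▸ H.comp_left a.J)
  refine ⟨fun H => hRn (H.finiteRankApproximable hRc), R, a.J, fun y => ?_, hRc,
    fun f => ⟨a.integrableOn_toFun f, a.J_coe f⟩, hJR, hL, hRn⟩
  rw [UniformSpace.Completion.coe_smul]
  rfl
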